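/- Let $I$ be a finite set, let $(n_{ij})_{i,j\in I}$ be a Coxeter matrix ($n_{ii}=1$ and $n_{ij}=n_{ji}\in\{2,3,\dots\}\cup\{\infty\}$ for $i\neq j$), and let $W=\langle s_i\ (i\in I)\mid (s_is_j)^{n_{ij}}=1 \text{ whenever } n_{ij}<\infty\rangle$ be its Coxeter group. Call distinct $i,j\in I$ adjacent if $n_{ij}\neq 2$. Let $C=(c_{ij})_{i,j\in I}$ be a real matrix (not necessarily symmetric) such that $c_{ii}=2$ for all $i$; $c_{ij}=0$ if $i\neq j$ are not adjacent; and, if $i,j$ are adjacent, $c_{ij},c_{ji}<0$ with $c_{ij}c_{ji}=4\cos^2(\pi/n_{ij})$ when $n_{ij}<\infty$ and $c_{ij}c_{ji}\ge 4$ when $n_{ij}=\infty$. Let $\alpha_i$ ($i\in I$) be the standard basis vectors of $\mathbb{R}^I$, and let $W$ act linearly on $\mathbb{R}^I$ by $$s_i(\beta)_j=\beta_j\ \ (j\neq i),\qquad s_i(\beta)_i=-\beta_i-\sum_{k\neq i}c_{ik}\beta_k .$$ Let $\Delta=\bigcup_{i\in I}W\alpha_i$ be the set of (real) roots, and let $\Delta_+\subset\Delta$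 be the set of positive roots, i.e. the roots all of whose coordinates are nonnegative. For $\alpha,\beta\in\Delta_+$ write $\alpha<\beta$ if there are $m\ge 1$, positive roots $\alpha=\gamma_0,\gamma_1,\dots,\gamma_m=\beta$ and $i_1,\dots,i_m\in I$ with $\gamma_r=s_{i_r}\gamma_{r-1}$ and $(\gamma_{r-1})_{i_r}<(\gamma_r)_{i_r}$ for $r=1,\dots,m$; write $\alpha\le\beta$ if $\alpha=\beta$ or $\alpha<\beta$ (the depth ordering). If $c_{ij}=c_{ji}$ for all $i,j\in I$ such that $n_{ij}$ is (finite and) odd, then for every $\beta\in\Delta_+$ there exists $i\in I$ with $\alpha_i\le\beta$. -/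

import Mathlib

namespace NumbersGame

/-- The Coxeter graph of a Coxeter matrix `n`: two distinct vertices are adjacent when their
simple reflections do not commute, that is, when `n i j ≠ 2`. (In Mathlib's `CoxeterMatrix`,
the entry `0` stands for `n i j = ∞`.) -/
def coxeterGraph {I : Type*} (n : CoxeterMatrix I) : SimpleGraph I where
  Adj i j := i ≠ j ∧ n i j ≠ 2
  symm := ⟨fun i j h => ⟨h.1.symm, by rw [n.symmetric j i]; exact h.2⟩⟩
  loopless := ⟨fun _ h => h.1 rfl⟩

/-- `C` is a (real, not necessarily symmetric or symmetrizable) Cartan matrix for the Coxeter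
matrix `n`. The entry `n i j = 0` encodes `n i j = ∞`. -/
structure IsCartanMatrix {I : Type*} (n : CoxeterMatrix I) (C : Matrix I I ℝ) : Prop where
  diag : ∀ i, C i i = 2
  not_adj : ∀ i j, i ≠ j → ¬ (coxeterGraph n).Adj i j → C i j = 0
  adj_neg : ∀ i j, (coxeterGraph n).Adj i j → C i j < 0
  adj_finite : ∀ i j, (coxeterGraph n).Adj i j → n i j ≠ 0 →
    C i j * C j i = 4 * Real.cos (Real.pi / (n i j : ℝ)) ^ 2
  adj_infinite : ∀ i j, (coxeterGraph n).Adj i j → n i j = 0 → 4 ≤ C i j * C j i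

/-- The linear form `β ↦ ∑ k, c_{ik} β_k`. -/
def simpleCoroot {I : Type*} [Fintype I] (C : Matrix I I ℝ) (i : I) : Module.Dual ℝ (I → ℝ) :=
  LinearMap.proj i ∘ₗ C.mulVecLin

theorem simpleCoroot_apply {I : Type*} [Fintype I] (C : Matrix I I ℝ) (i : I) (β : I → ℝ) :
    simpleCoroot C i β = ∑ k, C i k * β k := rfl

section

variable {I : Type*} [Fintype I] [DecidableEq I]

/-- The simple root `α_i`, the `i`-th elementary vector of `ℝ^I`. -/
def simpleRoot (i : I) : I → ℝ := Pi.single i 1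

/-- The simple reflection `s_i`, `β ↦ β - (∑ k, c_{ik} β_k) α_i`, on `ℝ^I`. -/
def simpleReflection (C : Matrix I I ℝ) (i : I) : Module.End ℝ (I → ℝ) :=
  Module.preReflection (simpleRoot i) (simpleCoroot C i)

theorem simpleCoroot_simpleRoot (C : Matrix I I ℝ) (i j : I) :
    simpleCoroot C i (simpleRoot j) = C i j := by
  simp [simpleCoroot_apply, simpleRoot, Pi.single_apply]

/-- The coordinates of `s_i β`. -/
theorem simpleReflection_apply {n : CoxeterMatrix I} {C : Matrix I I ℝ}
    (hC : IsCartanMatrix n C) (i : I) (β : I → ℝ) (j : I) :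
    simpleReflection C i β j =
      if j ≠ i then β j else - β i - ∑ k ∈ Finset.univ.erase i, C i k * β k := by
  have h := Finset.add_sum_erase Finset.univ (fun k => C i k * β k) (Finset.mem_univ i)
  have h2 := hC.diag i
  by_cases hj : j = i
  · subst hj
    simp only [simpleReflection, Module.preReflection_apply, simpleCoroot_apply, simpleRoot,
      Pi.sub_apply, Pi.smul_apply, Pi.single_eq_same, smul_eq_mul, ne_eq, not_true_eq_false,
      if_false]
    rw [← h, h2]
    ring
  · simp [simpleReflection, Module.preReflection_apply, simpleRoot, hj]

/-- The vanishing behind the relation `(s_i s_j)^m = 1`, for `3 ≤ m`. -/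
theorem chebyshev_coeffs {m : ℕ} (hm : 3 ≤ m) (t : ℝ)
    (ht : t = 2 * Real.cos (2 * Real.pi / m)) :
    ((Polynomial.Chebyshev.S ℝ (((m : ℤ) - 2) / 2)).eval t *
      ((Polynomial.Chebyshev.S ℝ (((m : ℤ) - 1) / 2)).eval t +
        (Polynomial.Chebyshev.S ℝ (((m : ℤ) - 3) / 2)).eval t) = 0) ∧
    ((Polynomial.Chebyshev.S ℝ (((m : ℤ) - 1) / 2)).eval t *
      ((Polynomial.Chebyshev.S ℝ ((m : ℤ) / 2)).eval t +
        (Polynomial.Chebyshev.S ℝ (((m : ℤ) - 2) / 2)).eval t) = 0) := by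
  have hm0 : (0 : ℝ) < m := by positivity
  have hm3 : (3 : ℝ) ≤ m := by exact_mod_cast hm
  set θ : ℝ := 2 * Real.pi / m with hθ
  have hmθ : (m : ℝ) * θ = 2 * Real.pi := by rw [hθ]; field_simp
  have hpi := Real.pi_pos
  have hs : Real.sin θ ≠ 0 := by
    apply ne_of_gt
    apply Real.sin_pos_of_pos_of_lt_pi
    · positivity
    · nlinarith
  have hS : ∀ k : ℤ, (Polynomial.Chebyshev.S ℝ k).eval t * Real.sin θ
      = Real.sin ((k + 1) * θ) := fun k => by
    rw [ht]; exact Polynomial.Chebyshev.S_two_mul_real_cos θ k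
  rcases Nat.even_or_odd' m with ⟨k, hk | hk⟩
  · have e1 : ((m : ℤ) - 2) / 2 = (k : ℤ) - 1 := by omega
    have e2 : ((m : ℤ) - 1) / 2 = (k : ℤ) - 1 := by omega
    have hz : (Polynomial.Chebyshev.S ℝ ((k : ℤ) - 1)).eval t = 0 := by
      have h := hS ((k : ℤ) - 1)
      have hkθ : (((k : ℤ) - 1 : ℤ) + 1 : ℝ) * θ = Real.pi := by
        have : (m : ℝ) = 2 * k := by exact_mod_cast hk
        push_cast
        rw [this] at hmθ
        linarith
      rw [hkθ, Real.sin_pi] at h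
      exact (mul_eq_zero.mp h).resolve_right hs
    rw [e1, e2, hz]
    simp
  · have e1 : ((m : ℤ) - 2) / 2 = (k : ℤ) - 1 := by omega
    have e2 : ((m : ℤ) - 1) / 2 = (k : ℤ) := by omega
    have e3 : ((m : ℤ) - 3) / 2 = (k : ℤ) - 1 := by omega
    have e4 : (m : ℤ) / 2 = (k : ℤ) := by omega
    have hz : (Polynomial.Chebyshev.S ℝ (k : ℤ)).eval t +
        (Polynomial.Chebyshev.S ℝ ((k : ℤ) - 1)).eval t = 0 := by
      have h1 := hS k
      have h2 := hS ((k : ℤ) - 1)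
      have hkθ : (((k : ℤ) : ℝ) + 1) * θ =
          2 * Real.pi - (((k : ℤ) - 1 : ℤ) + 1 : ℝ) * θ := by
        have : (m : ℝ) = 2 * k + 1 := by exact_mod_cast hk
        push_cast
        rw [this] at hmθ
        linarith
      rw [hkθ, Real.sin_two_pi_sub] at h1
      have : ((Polynomial.Chebyshev.S ℝ (k : ℤ)).eval t +
        (Polynomial.Chebyshev.S ℝ ((k : ℤ) - 1)).eval t) * Real.sin θ = 0 := by
        rw [add_mul, h1, h2]; ring
      exact (mul_eq_zero.mp this).resolve_right hs
    rw [e1, e2, e3, e4, hz]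
    simp

/-- The simple reflections satisfy the Coxeter relations. -/
theorem simpleReflection_isLiftable {n : CoxeterMatrix I} {C : Matrix I I ℝ}
    (hC : IsCartanMatrix n C) : n.IsLiftable (simpleReflection C) := by
  have hd : ∀ i, simpleCoroot C i (simpleRoot i) = 2 := fun i => by
    rw [simpleCoroot_simpleRoot, hC.diag]
  have hsq : ∀ i, simpleReflection C i * simpleReflection C i = 1 := fun i =>
    LinearMap.ext fun β => Module.involutive_preReflection (hd i) β
  intro i j
  by_cases hij : i = j
  · subst hij
    rw [hsq, one_pow]
  by_cases h2 : n i j = 2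
  · have cij : C i j = 0 := hC.not_adj i j hij fun h => h.2 h2
    have cji : C j i = 0 := hC.not_adj j i (Ne.symm hij) fun h => h.2 (by rw [n.symmetric, h2])
    have hcomm : simpleReflection C i * simpleReflection C j
        = simpleReflection C j * simpleReflection C i := by
      refine LinearMap.ext fun β => ?_
      simp only [simpleReflection, Module.End.mul_apply, Module.preReflection_apply, map_sub,
        map_smul, simpleCoroot_simpleRoot, cij, cji, sub_zero, zero_smul]
      abel
    rw [h2, pow_two]
    calc _ = simpleReflection C i * (simpleReflection C j * simpleReflection C i) *
          simpleReflection C j := by simp only [mul_assoc]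
      _ = (simpleReflection C i * simpleReflection C i) *
          (simpleReflection C j * simpleReflection C j) := by
            rw [← hcomm]; simp only [mul_assoc]
      _ = 1 := by rw [hsq, hsq, one_mul]
  by_cases h0 : n i j = 0
  · rw [h0, pow_zero]
  have h1 := n.off_diagonal i j hij
  have hm : 3 ≤ n i j := by
    have : n i j ≠ 1 := h1
    omega
  have hprod := hC.adj_finite i j ⟨hij, h2⟩ h0
  have ht : simpleCoroot C i (simpleRoot j) * simpleCoroot C j (simpleRoot i) - 2
      = 2 * Real.cos (2 * Real.pi / (n i j : ℕ)) := by
    rw [simpleCoroot_simpleRoot, simpleCoroot_simpleRoot, hprod, mul_div_assoc, Real.cos_two_mul]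
    ring
  obtain ⟨ha, hb⟩ := chebyshev_coeffs hm _ ht
  refine LinearMap.ext fun β => ?_
  have key := Module.reflection_mul_reflection_pow_apply (hd i) (hd j) (n i j) β
  rw [mul_comm (simpleCoroot C j _)] at key
  have hre : ∀ k β, ((Module.reflection (hd i) * Module.reflection (hd j)) ^ k) β =
      ((simpleReflection C i * simpleReflection C j) ^ k) β := by
    intro k
    induction k with
    | zero => intro β; rfl
    | succ k ih => intro β; rw [pow_succ, pow_succ]; exact ih _
  rw [hre] at key
  rw [key, ha, hb]
  simp

/-- The reflection action of the Coxeter group `W` with Coxeter matrix `n` on `ℝ^I`: the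
generator `s_i` acts by the simple reflection attached to `i`. -/
noncomputable def reflectionRep {n : CoxeterMatrix I} {C : Matrix I I ℝ}
    (hC : IsCartanMatrix n C) : n.Group →* Module.End ℝ (I → ℝ) :=
  n.toCoxeterSystem.lift ⟨simpleReflection C, simpleReflection_isLiftable hC⟩

theorem reflectionRep_simple {n : CoxeterMatrix I} {C : Matrix I I ℝ}
    (hC : IsCartanMatrix n C) (i : I) :
    reflectionRep hC (n.simple i) = simpleReflection C i := by
  rw [← n.toCoxeterSystem_simple]
  exact n.toCoxeterSystem.lift_apply_simple (simpleReflection_isLiftable hC) i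

/-- The set `Δ = ⋃ i, W α_i` of (real) roots. -/
def roots {n : CoxeterMatrix I} {C : Matrix I I ℝ} (hC : IsCartanMatrix n C) : Set (I → ℝ) :=
  {β | ∃ (i : I) (w : n.Group), β = reflectionRep hC w (simpleRoot i)}

/-- The set `Δ₊` of positive roots: the roots all of whose entries are nonnegative. -/
def positiveRoots {n : CoxeterMatrix I} {C : Matrix I I ℝ} (hC : IsCartanMatrix n C) :
    Set (I → ℝ) :=
  {β | β ∈ roots hC ∧ ∀ j, 0 ≤ β j}

/-- One step of the depth ordering: a positive root `α` lies below the positive root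
`β = s_i α` when `α_i < (s_i α)_i`. -/
def DepthStep {n : CoxeterMatrix I} {C : Matrix I I ℝ} (hC : IsCartanMatrix n C)
    (α β : I → ℝ) : Prop :=
  α ∈ positiveRoots hC ∧ β ∈ positiveRoots hC ∧
    ∃ i, β = simpleReflection C i α ∧ α i < simpleReflection C i α i

/-- The strict depth ordering on positive roots: `α < β` when there is a sequence
`α < s_{i₁} α < ⋯ < s_{i_m} ⋯ s_{i₁} α = β` of at least one step. -/
def DepthLT {n : CoxeterMatrix I} {C : Matrix I I ℝ} (hC : IsCartanMatrix n C)
    (α β : I → ℝ) : Prop :=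
  Relation.TransGen (DepthStep hC) α β

/-- The depth ordering `α ≤ β`: either `α = β` or `α < β`. -/
def DepthLE {n : CoxeterMatrix I} {C : Matrix I I ℝ} (hC : IsCartanMatrix n C)
    (α β : I → ℝ) : Prop :=
  α = β ∨ DepthLT hC α β

end

end NumbersGame

/-! Every root `β` is made nonpositive by some `w`. Take `w` shortest for a positive `β` and let `i`
be a right descent of `w`. Then `w α_i ≤ 0`, and minimality forces the coroot of `i` to be positive
on `β`, so `s_i β` is lower in the `i`-th coordinate. Unless `β = α_i`, the root `s_i β` is again
positive, and the shorter `w s_i` makes it nonpositive; induction on length ends at a simple root.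

Two facts carry this: the sign of `w α_i` is decided by whether `i` is a right descent of `w`
(`reflectionRep_simpleRoot_nonneg`), and the only nonnegative multiple of `α_i` that is a root is
`α_i` itself (`eq_one_of_reflectionRep_eq_smul`). Both reduce to rank two by splitting off an
alternating word. The symmetry of odd bonds matters only for the second: the longest word of an odd
dihedral group sends `α_i` to a multiple of `α_j`, and symmetry makes the factor 1. -/

namespace NumbersGame

/-! ### Recursions for the coordinates of roots in rank two. -/

section Dihedral

/-- The coefficient sequences along an infinite dihedral orbit of a simple root are positive. -/
theorem dihedral_coeffs_pos {q : ℝ} (hq : 4 ≤ q) {a b : ℕ → ℝ} (ha0 : a 0 = 1) (hb0 : b 0 = 0)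
    (hb : ∀ k, b (k + 1) = a k - b k) (ha : ∀ k, a (k + 1) = q * b (k + 1) - a k) (k : ℕ) :
    0 < a k ∧ 0 ≤ b k ∧ 2 * b k ≤ a k ∧ 0 < b (k + 1) := by
  induction k with
  | zero => rw [hb, ha0, hb0]; norm_num
  | succ k ih =>
    obtain ⟨h1, h2, h3, h4⟩ := ih
    have h5 := hb k
    -- The invariant `2 b ≤ a` propagates exactly because `q - 2 ≥ 2`.
    have h6 : 2 * b (k + 1) ≤ a (k + 1) := by
      rw [ha]
      nlinarith
    refine ⟨by linarith, h4.le, h6, ?_⟩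
    rw [hb (k + 1)]
    linarith

/-- The coefficient sequences along a finite dihedral orbit of a simple root. -/
theorem dihedral_coeffs_eq_sin {θ : ℝ} (hs : Real.sin θ ≠ 0) (hc : Real.cos θ ≠ 0)
    {a b : ℕ → ℝ} (ha0 : a 0 = 1) (hb0 : b 0 = 0) (hb : ∀ k, b (k + 1) = a k - b k)
    (ha : ∀ k, a (k + 1) = 4 * Real.cos θ ^ 2 * b (k + 1) - a k) (k : ℕ) :
    a k = Real.sin ((2 * k + 1) * θ) / Real.sin θ ∧
      b k = Real.sin (2 * k * θ) / (2 * Real.sin θ * Real.cos θ) := by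
  have key : ∀ x, Real.sin (x + θ) + Real.sin (x - θ) = 2 * Real.sin x * Real.cos θ := fun x => by
    rw [Real.sin_add, Real.sin_sub]; ring
  induction k with
  | zero => simp [ha0, hb0, hs]
  | succ k ih =>
    obtain ⟨iha, ihb⟩ := ih
    have h1 := key ((2 * k + 1) * θ)
    have h2 := key (2 * (k + 1 : ℕ) * θ)
    have e1 : (2 * (k : ℝ) + 1) * θ + θ = 2 * (k + 1 : ℕ) * θ := by push_cast; ring
    have e2 : (2 * (k : ℝ) + 1) * θ - θ = 2 * k * θ := by ring
    have e3 : 2 * ((k + 1 : ℕ) : ℝ) * θ + θ = (2 * (k + 1 : ℕ) + 1) * θ := by ring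
    have e4 : 2 * ((k + 1 : ℕ) : ℝ) * θ - θ = (2 * k + 1) * θ := by push_cast; ring
    rw [e1, e2] at h1
    rw [e3, e4] at h2
    have hb' : b (k + 1) =
        Real.sin (2 * (k + 1 : ℕ) * θ) / (2 * Real.sin θ * Real.cos θ) := by
      rw [hb, iha, ihb, eq_sub_of_add_eq h1]
      field_simp
    refine ⟨?_, hb'⟩
    rw [ha, hb', iha, eq_sub_of_add_eq h2]
    field_simp
    ring

end Dihedral

/-! ### Nonnegative vectors and multiples of simple roots. -/

section

variable {I : Type*} [DecidableEq I]

theorem simpleRoot_ne_zero (i : I) : simpleRoot i ≠ (0 : I → ℝ) := by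
  simp [simpleRoot]

theorem simpleRoot_nonneg (i : I) : (0 : I → ℝ) ≤ simpleRoot i := by
  simp [simpleRoot]

theorem eq_smul_simpleRoot {β : I → ℝ} {i : I} (h : ∀ j, j ≠ i → β j = 0) :
    β = β i • simpleRoot i := by
  funext j
  by_cases hj : j = i
  · subst hj; simp [simpleRoot]
  · simp [simpleRoot, hj, h j hj]

/-- Nonnegative terms cannot cancel in the coordinates other than `i`. -/
theorem eq_smul_of_smul_add_smul_eq {u v : I → ℝ} (hu : 0 ≤ u) (hv : 0 ≤ v) {x y c : ℝ}
    (hx : 0 < x) (hy : 0 ≤ y) {i : I} (h : x • u + y • v = c • simpleRoot i) :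
    u = u i • simpleRoot i := by
  refine eq_smul_simpleRoot fun j hj => ?_
  have h1 : x * u j + y * v j = 0 := by simpa [simpleRoot, hj] using congrFun h j
  have h2 := mul_nonneg hy (hv j)
  have h3 := mul_nonneg hx.le (hu j)
  exact (mul_eq_zero.mp (by linarith : x * u j = 0)).resolve_left hx.ne'

end

/-! ### Dihedral orbits of a simple root. -/

section

variable {I : Type*} [Fintype I] [DecidableEq I] {n : CoxeterMatrix I} {C : Matrix I I ℝ}

theorem simpleReflection_smul_add_smul (i j k : I) (x y : ℝ) :
    simpleReflection C k (x • simpleRoot i + y • simpleRoot j) =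
      x • simpleRoot i + y • simpleRoot j - (x * C k i + y * C k j) • simpleRoot k := by
  simp [simpleReflection, Module.preReflection_apply, simpleCoroot_simpleRoot]

/-- The words end in `j`, so `s_j` acts first. With `-C j i` factored out of the `α_j` coordinate,
the recursions depend on `C` only through the product `C i j * C j i`. -/
theorem reflectionRep_alternatingWord_even_odd (hC : IsCartanMatrix n C) (i j : I)
    {a b : ℕ → ℝ} (ha0 : a 0 = 1) (hb0 : b 0 = 0) (hb : ∀ k, b (k + 1) = a k - b k)
    (ha : ∀ k, a (k + 1) = C i j * C j i * b (k + 1) - a k) (k : ℕ) :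
    (reflectionRep hC (n.toCoxeterSystem.wordProd (CoxeterSystem.alternatingWord i j (2 * k)))
        (simpleRoot i) = a k • simpleRoot i + (-C j i * b k) • simpleRoot j) ∧
    (reflectionRep hC (n.toCoxeterSystem.wordProd
        (CoxeterSystem.alternatingWord i j (2 * k + 1))) (simpleRoot i) =
      a k • simpleRoot i + (-C j i * b (k + 1)) • simpleRoot j) := by
  have hodd : ∀ k, reflectionRep hC (n.toCoxeterSystem.wordProd
      (CoxeterSystem.alternatingWord i j (2 * k))) (simpleRoot i) =
        a k • simpleRoot i + (-C j i * b k) • simpleRoot j →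
      reflectionRep hC (n.toCoxeterSystem.wordProd
        (CoxeterSystem.alternatingWord i j (2 * k + 1))) (simpleRoot i) =
      a k • simpleRoot i + (-C j i * b (k + 1)) • simpleRoot j := by
    intro k h
    rw [CoxeterSystem.alternatingWord_succ', if_pos (even_two_mul k), CoxeterSystem.wordProd_cons,
      map_mul, Module.End.mul_apply, h, n.toCoxeterSystem_simple, reflectionRep_simple,
      simpleReflection_smul_add_smul, hC.diag, hb]
    module
  induction k with
  | zero =>
    have h0 : reflectionRep hC (n.toCoxeterSystem.wordProd
        (CoxeterSystem.alternatingWord i j (2 * 0))) (simpleRoot i) =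
          a 0 • simpleRoot i + (-C j i * b 0) • simpleRoot j := by
      simp [CoxeterSystem.alternatingWord, ha0, hb0]
    exact ⟨h0, hodd 0 h0⟩
  | succ k ih =>
    have h1 : reflectionRep hC (n.toCoxeterSystem.wordProd
        (CoxeterSystem.alternatingWord i j (2 * (k + 1)))) (simpleRoot i) =
          a (k + 1) • simpleRoot i + (-C j i * b (k + 1)) • simpleRoot j := by
      rw [show 2 * (k + 1) = 2 * k + 1 + 1 by ring, CoxeterSystem.alternatingWord_succ',
        if_neg (by simp [parity_simps]), CoxeterSystem.wordProd_cons,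
        map_mul, Module.End.mul_apply, ih.2, n.toCoxeterSystem_simple, reflectionRep_simple,
        simpleReflection_smul_add_smul, hC.diag, ha]
      module
    exact ⟨h1, hodd (k + 1) h1⟩

/-- A reduced alternating word not ending in `i` sends `α_i` to a nonnegative combination of `α_i`
and `α_j`, and if the result is a multiple of one of these then it is equal to it, provided that
odd bonds are symmetric. -/
theorem exists_reflectionRep_alternatingWord_eq (hC : IsCartanMatrix n C) {i j : I} (hij : i ≠ j)
    (m : ℕ) (hm : n i j ≠ 0 → m + 1 ≤ n i j) :
    ∃ x y : ℝ, 0 ≤ x ∧ 0 ≤ y ∧ ((Odd (n i j) → C i j = C j i) → x = 0 → y = 1) ∧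
      (y = 0 → x = 1) ∧
      reflectionRep hC (n.toCoxeterSystem.wordProd (CoxeterSystem.alternatingWord i j m))
        (simpleRoot i) = x • simpleRoot i + y • simpleRoot j := by
  let p : ℕ → ℝ × ℝ := fun k => Nat.rec (1, 0)
    (fun _ z => (C i j * C j i * (z.1 - z.2) - z.1, z.1 - z.2)) k
  obtain ⟨a, b, ha0, hb0, hb, ha⟩ : ∃ a b : ℕ → ℝ, a 0 = 1 ∧ b 0 = 0 ∧
      (∀ k, b (k + 1) = a k - b k) ∧ (∀ k, a (k + 1) = C i j * C j i * b (k + 1) - a k) :=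
    ⟨fun k => (p k).1, fun k => (p k).2, rfl, rfl, fun _ => rfl, fun _ => rfl⟩
  have hrep := reflectionRep_alternatingWord_even_odd hC i j ha0 hb0 hb ha
  by_cases h2 : n i j = 2
  · have hji : C j i = 0 := hC.not_adj j i hij.symm fun h => h.2 (by rw [n.symmetric, h2])
    have hm1 : m ≤ 1 := by have := hm (by omega); omega
    refine ⟨1, 0, by norm_num, le_rfl, by norm_num, by norm_num, ?_⟩
    interval_cases m
    · simpa [hji, ha0] using (hrep 0).1
    · simpa [hji, ha0] using (hrep 0).2
  have hadj : (coxeterGraph n).Adj i j := ⟨hij, h2⟩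
  have hji := hC.adj_neg j i hadj.symm
  by_cases h0 : n i j = 0
  · have hpos := dihedral_coeffs_pos (hC.adj_infinite i j hadj h0) ha0 hb0 hb ha
    rcases Nat.even_or_odd' m with ⟨k, rfl | rfl⟩
    · refine ⟨_, _, (hpos k).1.le, mul_nonneg (by linarith) (hpos k).2.1,
        fun _ h => absurd h (hpos k).1.ne', fun h => ?_, (hrep k).1⟩
      -- Only the empty word leaves the `α_j` coordinate zero.
      rcases k with _ | k
      · exact ha0
      · exact absurd h (mul_pos (by linarith) (hpos k).2.2.2).ne'
    · exact ⟨_, _, (hpos k).1.le, (mul_pos (by linarith) (hpos k).2.2.2).le,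
        fun _ h => absurd h (hpos k).1.ne',
        fun h => absurd h (mul_pos (by linarith) (hpos k).2.2.2).ne', (hrep k).2⟩
  have h1 := n.off_diagonal i j hij
  have h3 : 3 ≤ n i j := by omega
  have hprod := hC.adj_finite i j hadj h0
  replace hm := hm h0
  set N := n i j with hN
  set θ : ℝ := Real.pi / N with hθ
  have hN0 : (0 : ℝ) < N := by positivity
  have hN3 : (3 : ℝ) ≤ N := by exact_mod_cast h3
  have hNθ : (N : ℝ) * θ = Real.pi := by rw [hθ]; field_simp
  have hpi := Real.pi_pos
  have hθ0 : 0 < θ := by positivity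
  have hs : 0 < Real.sin θ := Real.sin_pos_of_pos_of_lt_pi hθ0 (by nlinarith)
  have hc : 0 < Real.cos θ := Real.cos_pos_of_mem_Ioo ⟨by linarith, by nlinarith⟩
  rw [hprod] at ha
  have hsin := dihedral_coeffs_eq_sin hs.ne' hc.ne' ha0 hb0 hb ha
  have hden : 0 < 2 * Real.sin θ * Real.cos θ := by positivity
  have sin_nonneg : ∀ l : ℕ, l ≤ N → 0 ≤ Real.sin (l * θ) := fun l hl =>
    Real.sin_nonneg_of_nonneg_of_le_pi (by positivity) (by
      rw [← hNθ]
      have : (l : ℝ) ≤ N := by exact_mod_cast hl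
      gcongr)
  have sin_eq_zero : ∀ l : ℕ, 0 < l → l ≤ N → Real.sin (l * θ) = 0 → l = N := fun l hl0 hl h => by
    by_contra hne
    have hlt : (l : ℝ) < N := by exact_mod_cast lt_of_le_of_ne hl hne
    have hl0' : (0 : ℝ) < l := by exact_mod_cast hl0
    exact (Real.sin_pos_of_pos_of_lt_pi (by positivity)
      (by rw [← hNθ]; exact mul_lt_mul_of_pos_right hlt hθ0)).ne' h
  have sin_pred : ∀ l : ℕ, l + 1 = N → Real.sin (l * θ) = Real.sin θ := fun l hl => by
    have : (l : ℝ) * θ = Real.pi - θ := by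
      rw [← hNθ, ← hl]; push_cast; ring
    rw [this, Real.sin_pi_sub]
  have ha' : ∀ k, a k = Real.sin ((2 * k + 1 : ℕ) * θ) / Real.sin θ := fun k => by
    rw [(hsin k).1]; push_cast; rfl
  have hb' : ∀ k, b k = Real.sin ((2 * k : ℕ) * θ) / (2 * Real.sin θ * Real.cos θ) := fun k => by
    rw [(hsin k).2]; push_cast; rfl
  have ha_nonneg : ∀ k, 2 * k + 1 ≤ N → 0 ≤ a k := fun k hk => by
    rw [ha']; exact div_nonneg (sin_nonneg _ hk) hs.le
  have hb_nonneg : ∀ k, 2 * k ≤ N → 0 ≤ b k := fun k hk => by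
    rw [hb']; exact div_nonneg (sin_nonneg _ hk) hden.le
  have ha_zero : ∀ k, 2 * k + 1 ≤ N → a k = 0 → 2 * k + 1 = N := fun k hk h => by
    rw [ha', div_eq_zero_iff] at h
    exact sin_eq_zero _ (by omega) hk (h.resolve_right hs.ne')
  have hb_zero : ∀ k, 0 < k → 2 * k ≤ N → b k = 0 → 2 * k = N := fun k hk0 hk h => by
    rw [hb', div_eq_zero_iff] at h
    exact sin_eq_zero _ (by omega) hk (h.resolve_right hden.ne')
  have hji' : -C j i ≠ 0 := by linarith
  rcases Nat.even_or_odd' m with ⟨k, rfl | rfl⟩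
  · refine ⟨_, _, ha_nonneg k (by omega), mul_nonneg (by linarith) (hb_nonneg k (by omega)),
      fun hsymm h => ?_, fun h => ?_, (hrep k).1⟩
    · have hk := ha_zero k (by omega) h
      rw [hb', sin_pred _ hk]
      -- Here the bond is odd, `N = 2k + 1`, and the `α_j` coordinate is `-C j i / (2 cos θ)`;
      -- symmetry makes it 1.
      have hCC : C j i = -(2 * Real.cos θ) := by
        rw [hsymm ⟨k, hk.symm⟩] at hprod
        nlinarith
      rw [hCC]
      field_simp
    · have hbk := (mul_eq_zero.mp h).resolve_left hji'
      rcases k.eq_zero_or_pos with rfl | hk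
      · exact ha0
      · have := hb_zero k hk (by omega) hbk
        omega
  · refine ⟨_, _, ha_nonneg k (by omega), mul_nonneg (by linarith) (hb_nonneg (k + 1) (by omega)),
      fun _ h => ?_, fun h => ?_, (hrep k).2⟩
    · have := ha_zero k (by omega) h
      omega
    -- Here `N = 2k + 2` is even; the `α_i` coordinate is `sin (π - θ) / sin θ = 1`, whether or not
    -- the bond is symmetric.
    · have := hb_zero (k + 1) (by omega) (by omega) ((mul_eq_zero.mp h).resolve_left hji')
      rw [ha', sin_pred _ (by omega), div_self hs.ne']

end

/-! ### Splitting off a rank-two factor in the Coxeter group. -/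

/-- Every group element without right descent `i` factors, with lengths adding, as an element
without right descents `i`, `j` times an alternating word in `i`, `j` not ending in `i`. -/
theorem exists_eq_mul_alternatingWord {B W : Type*} [Group W] {M : CoxeterMatrix B}
    (cs : CoxeterSystem M W) (w : W) (i j : B) (hi : ¬ cs.IsRightDescent w i) :
    ∃ v m, w = v * cs.wordProd (CoxeterSystem.alternatingWord i j m) ∧
      cs.length w = cs.length v + m ∧ ¬ cs.IsRightDescent v i ∧ ¬ cs.IsRightDescent v j := by
  induction hl : cs.length w generalizing w i j with
  | zero =>
    exact ⟨w, 0, by simp [CoxeterSystem.alternatingWord], by omega, hi,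
      by simp [CoxeterSystem.IsRightDescent, hl]⟩
  | succ l ih =>
    by_cases hj : cs.IsRightDescent w j
    · have h1 := cs.isRightDescent_iff.mp hj
      have h2 := cs.isRightDescent_iff_not_isRightDescent_mul.mp hj
      -- Once `j` is removed it is no longer a right descent, so `i` and `j` exchange roles.
      obtain ⟨v, m, hv, hlen, hvj, hvi⟩ := ih (w * cs.simple j) j i h2 (by omega)
      refine ⟨v, m + 1, ?_, by omega, hvi, hvj⟩
      rw [CoxeterSystem.alternatingWord_succ, List.concat_eq_append,
      cs.wordProd_append, ← mul_assoc, ← hv,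
        cs.wordProd_singleton, cs.simple_mul_simple_cancel_right]
    · exact ⟨w, 0, by simp [CoxeterSystem.alternatingWord], by omega, hi, hj⟩

/-- Multiplying by `s_i` still adds length, so the alternating word of length `m + 1` is reduced;
its length is then at most the order of the bond. -/
theorem succ_le_of_not_isRightDescent {B W : Type*} [Group W] {M : CoxeterMatrix B}
    (cs : CoxeterSystem M W) {v w : W} {i j : B} {m : ℕ}
    (hw : w = v * cs.wordProd (CoxeterSystem.alternatingWord i j m))
    (hlen : cs.length w = cs.length v + m) (hi : ¬ cs.IsRightDescent w i) (h0 : M i j ≠ 0) :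
    m + 1 ≤ M i j := by
  by_contra hlt
  have h0' : M j i ≠ 0 := by rwa [M.symmetric]
  refine cs.not_isReduced_alternatingWord j i (m := m + 1) h0' (by rw [M.symmetric]; omega) ?_
  have h1 := cs.not_isRightDescent_iff.mp hi
  have h2 : w * cs.simple i =
      v * cs.wordProd (CoxeterSystem.alternatingWord j i (m + 1)) := by
    rw [CoxeterSystem.alternatingWord_succ, List.concat_eq_append,
      cs.wordProd_append, ← mul_assoc, ← hw,
      cs.wordProd_singleton]
  have h3 := cs.length_mul_le v (cs.wordProd (CoxeterSystem.alternatingWord j i (m + 1)))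
  have h4 := cs.length_wordProd_le (CoxeterSystem.alternatingWord j i (m + 1))
  rw [← h2] at h3
  rw [CoxeterSystem.length_alternatingWord] at h4
  rw [CoxeterSystem.IsReduced, CoxeterSystem.length_alternatingWord]
  omega

/-! ### Signs of roots and multiples of simple roots. -/

section

variable {I : Type*} [Fintype I] [DecidableEq I] {n : CoxeterMatrix I} {C : Matrix I I ℝ}

/-- Reduction to a smaller group element of the image of `α_i` under `w`, when `j` is a right
descent of `w` and `i` is not. -/
theorem exists_reflectionRep_eq (hC : IsCartanMatrix n C) {w : n.Group} {i j : I}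
    (hi : ¬ n.toCoxeterSystem.IsRightDescent w i) (hj : n.toCoxeterSystem.IsRightDescent w j) :
    ∃ (v : n.Group) (x y : ℝ), n.toCoxeterSystem.length v < n.toCoxeterSystem.length w ∧
      ¬ n.toCoxeterSystem.IsRightDescent v i ∧ ¬ n.toCoxeterSystem.IsRightDescent v j ∧
      0 ≤ x ∧ 0 ≤ y ∧ ((Odd (n i j) → C i j = C j i) → x = 0 → y = 1) ∧ (y = 0 → x = 1) ∧
      reflectionRep hC w (simpleRoot i) =
        x • reflectionRep hC v (simpleRoot i) + y • reflectionRep hC v (simpleRoot j) := by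
  obtain ⟨v, m, hw, hlen, hvi, hvj⟩ := exists_eq_mul_alternatingWord n.toCoxeterSystem w i j hi
  have hij : i ≠ j := by rintro rfl; exact hi hj
  have hm : m ≠ 0 := by
    rintro rfl
    have : w = v := by simpa [CoxeterSystem.alternatingWord] using hw
    exact hvj (this ▸ hj)
  obtain ⟨x, y, hx, hy, hx0, hy0, h⟩ := exists_reflectionRep_alternatingWord_eq hC hij m
    (succ_le_of_not_isRightDescent n.toCoxeterSystem hw hlen hi)
  refine ⟨v, x, y, by omega, hvi, hvj, hx, hy, hx0, hy0, ?_⟩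
  conv_lhs => rw [hw, map_mul, Module.End.mul_apply, h]
  simp

theorem reflectionRep_injective (hC : IsCartanMatrix n C) (w : n.Group) :
    Function.Injective (reflectionRep hC w) := by
  refine Function.LeftInverse.injective (g := reflectionRep hC w⁻¹) fun β => ?_
  rw [← Module.End.mul_apply, ← map_mul, inv_mul_cancel, map_one, Module.End.one_apply]

theorem reflectionRep_simpleRoot_ne_zero (hC : IsCartanMatrix n C) (w : n.Group) (i : I) :
    reflectionRep hC w (simpleRoot i) ≠ 0 := fun h =>
  simpleRoot_ne_zero i (reflectionRep_injective hC w (h.trans (map_zero _).symm))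

theorem simpleReflection_simpleRoot_self (hC : IsCartanMatrix n C) (i : I) :
    simpleReflection C i (simpleRoot i) = -simpleRoot i := by
  rw [simpleReflection, Module.preReflection_apply, simpleCoroot_simpleRoot, hC.diag]
  module

/-- Induction on length: `w α_i` is a nonnegative combination of `v α_i` and `v α_j` with `v`
shorter and without right descents `i`, `j`. -/
theorem reflectionRep_simpleRoot_nonneg (hC : IsCartanMatrix n C) (w : n.Group) (i : I)
    (hi : ¬ n.toCoxeterSystem.IsRightDescent w i) :
    0 ≤ reflectionRep hC w (simpleRoot i) := by
  induction hl : n.toCoxeterSystem.length w using Nat.strong_induction_on generalizing w i with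
  | _ l ih =>
    subst hl
    by_cases hw : w = 1
    · subst hw
      simpa using simpleRoot_nonneg i
    obtain ⟨j, hj⟩ := n.toCoxeterSystem.exists_rightDescent_of_ne_one hw
    obtain ⟨v, x, y, hlt, hvi, hvj, hx, hy, -, -, h⟩ := exists_reflectionRep_eq hC hi hj
    rw [h]
    exact add_nonneg (smul_nonneg hx (ih _ hlt v i hvi rfl)) (smul_nonneg hy (ih _ hlt v j hvj rfl))

theorem reflectionRep_simpleRoot_nonpos (hC : IsCartanMatrix n C) (w : n.Group) (i : I)
    (hi : n.toCoxeterSystem.IsRightDescent w i) :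
    reflectionRep hC w (simpleRoot i) ≤ 0 := by
  have h := reflectionRep_simpleRoot_nonneg hC _ i
    (n.toCoxeterSystem.isRightDescent_iff_not_isRightDescent_mul.mp hi)
  rw [map_mul, n.toCoxeterSystem_simple, reflectionRep_simple, Module.End.mul_apply,
    simpleReflection_simpleRoot_self hC, map_neg] at h
  exact neg_nonneg.mp h

theorem nonneg_or_nonpos_of_mem_roots (hC : IsCartanMatrix n C) {β : I → ℝ}
    (hβ : β ∈ roots hC) : 0 ≤ β ∨ β ≤ 0 := by
  obtain ⟨i, w, rfl⟩ := hβ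
  by_cases hi : n.toCoxeterSystem.IsRightDescent w i
  · exact Or.inr (reflectionRep_simpleRoot_nonpos hC w i hi)
  · exact Or.inl (reflectionRep_simpleRoot_nonneg hC w i hi)

theorem ne_zero_of_mem_roots (hC : IsCartanMatrix n C) {β : I → ℝ} (hβ : β ∈ roots hC) :
    β ≠ 0 := by
  obtain ⟨i, w, rfl⟩ := hβ
  exact reflectionRep_simpleRoot_ne_zero hC w i

theorem reflectionRep_mem_roots (hC : IsCartanMatrix n C) (w : n.Group) {β : I → ℝ}
    (hβ : β ∈ roots hC) : reflectionRep hC w β ∈ roots hC := by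
  obtain ⟨i, v, rfl⟩ := hβ
  exact ⟨i, w * v, by rw [map_mul, Module.End.mul_apply]⟩

/-- If odd bonds are symmetric, no root is a positive multiple of a simple root except itself. -/
theorem eq_one_of_reflectionRep_eq_smul (hC : IsCartanMatrix n C)
    (hodd : ∀ i j : I, Odd (n i j) → C i j = C j i) (w : n.Group) (j i : I) {c : ℝ} (hc : 0 ≤ c)
    (h : reflectionRep hC w (simpleRoot j) = c • simpleRoot i) : c = 1 := by
  induction hl : n.toCoxeterSystem.length w using Nat.strong_induction_on generalizing w j with
  | _ l ih =>
    subst hl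
    by_cases hw : w = 1
    · subst hw
      have hj := congrFun h j
      rw [map_one] at hj
      by_cases hji : j = i
      · subst hji
        simpa [simpleRoot] using hj.symm
      · simp [simpleRoot, hji] at hj
    have hdj : ¬ n.toCoxeterSystem.IsRightDescent w j := fun hd => by
      refine reflectionRep_simpleRoot_ne_zero hC w j
        (le_antisymm (reflectionRep_simpleRoot_nonpos hC w j hd) ?_)
      rw [h]
      exact smul_nonneg hc (simpleRoot_nonneg i)
    obtain ⟨k, hk⟩ := n.toCoxeterSystem.exists_rightDescent_of_ne_one hw
    obtain ⟨v, x, y, hlt, hvj, hvk, hx, hy, hx0, hy0, hwv⟩ := exists_reflectionRep_eq hC hdj hk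
    rw [hwv] at h
    rcases hx.eq_or_lt with rfl | hx
    · rw [hx0 (hodd j k) rfl, zero_smul, zero_add, one_smul] at h
      exact ih _ hlt v k h rfl
    rcases hy.eq_or_lt with rfl | hy
    · rw [hy0 rfl, zero_smul, add_zero, one_smul] at h
      exact ih _ hlt v j h rfl
    -- With both coefficients positive, `v α_j` and `v α_k` would both lie on the line of `α_i`,
    -- contradicting injectivity of `v`.
    exfalso
    have pj := reflectionRep_simpleRoot_nonneg hC v j hvj
    have pk := reflectionRep_simpleRoot_nonneg hC v k hvk
    have ej := eq_smul_of_smul_add_smul_eq pj pk hx hy.le h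
    have ek := eq_smul_of_smul_add_smul_eq pk pj hy hx.le ((add_comm _ _).trans h)
    set cj := reflectionRep hC v (simpleRoot j) i
    set ck := reflectionRep hC v (simpleRoot k) i
    have hjk : j ≠ k := by rintro rfl; exact hdj hk
    have hker : ck • simpleRoot j = cj • (simpleRoot k : I → ℝ) := by
      apply reflectionRep_injective hC v
      rw [map_smul, map_smul, ej, ek]
      exact smul_comm _ _ _
    have hck : ck = 0 := by simpa [simpleRoot, hjk] using congrFun hker j
    rw [hck, zero_smul] at ek
    exact reflectionRep_simpleRoot_ne_zero hC v k ek

/-- A simple reflection keeps a positive root positive unless the root is the simple one. -/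
theorem simpleReflection_mem_positiveRoots (hC : IsCartanMatrix n C)
    (hodd : ∀ i j : I, Odd (n i j) → C i j = C j i) {β : I → ℝ} (hβ : β ∈ positiveRoots hC)
    {i : I} (hi : β ≠ simpleRoot i) : simpleReflection C i β ∈ positiveRoots hC := by
  have hroot : simpleReflection C i β ∈ roots hC := by
    rw [← reflectionRep_simple hC]
    exact reflectionRep_mem_roots hC _ hβ.1
  refine ⟨hroot, (nonneg_or_nonpos_of_mem_roots hC hroot).resolve_right fun hneg => hi ?_⟩
  -- Only the `i`-th coordinate changes under `s_i`, so a sign change forces all the others to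
  -- vanish.
  have hsm : β = β i • simpleRoot i := eq_smul_simpleRoot fun j hj => by
    have h := hneg j
    rw [simpleReflection_apply hC, if_pos hj] at h
    exact le_antisymm h (hβ.2 j)
  obtain ⟨j, w, hw⟩ := hβ.1
  have := eq_one_of_reflectionRep_eq_smul hC hodd w j i (hβ.2 i) (hw.symm.trans hsm)
  rw [hsm, this, one_smul]

/-! ### Descent in the depth ordering. -/

/-- The simple coroot at a last letter of a shortest element making `β` negative is positive
on `β`. -/
theorem simpleCoroot_pos_of_minimal (hC : IsCartanMatrix n C) {β : I → ℝ} {w : n.Group}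
    (hw : reflectionRep hC w β ≤ 0)
    (hmin : ∀ v, reflectionRep hC v β ≤ 0 →
      n.toCoxeterSystem.length w ≤ n.toCoxeterSystem.length v)
    {i : I} (hi : n.toCoxeterSystem.IsRightDescent w i) : 0 < simpleCoroot C i β := by
  by_contra! hle
  have hlt : n.toCoxeterSystem.length (w * n.toCoxeterSystem.simple i) <
      n.toCoxeterSystem.length w := hi
  refine absurd (hmin (w * n.toCoxeterSystem.simple i) ?_) (by omega)
  have hnp := reflectionRep_simpleRoot_nonpos hC w i hi
  -- If the coroot were nonpositive on `β`, both summands would be nonpositive and `w s_i` would be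
  -- a shorter choice.
  have hβ : reflectionRep hC (w * n.toCoxeterSystem.simple i) β =
      reflectionRep hC w β + (-simpleCoroot C i β) • reflectionRep hC w (simpleRoot i) := by
    rw [map_mul, n.toCoxeterSystem_simple, reflectionRep_simple, Module.End.mul_apply,
      simpleReflection, Module.preReflection_apply, map_sub, map_smul]
    module
  rw [hβ]
  exact add_nonpos hw (smul_nonpos_of_nonneg_of_nonpos (by linarith) hnp)

/-- For `β = w α_i`, the element `s_i w⁻¹` sends `β` to `-α_i`. -/
theorem exists_reflectionRep_nonpos (hC : IsCartanMatrix n C) {β : I → ℝ} (hβ : β ∈ roots hC) :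
    ∃ w, reflectionRep hC w β ≤ 0 := by
  obtain ⟨i, w, rfl⟩ := hβ
  refine ⟨n.simple i * w⁻¹, ?_⟩
  rw [← Module.End.mul_apply, ← map_mul, inv_mul_cancel_right, reflectionRep_simple,
    simpleReflection_simpleRoot_self hC]
  exact neg_nonpos.mpr (simpleRoot_nonneg i)

theorem exists_simpleRoot_depthLE (hC : IsCartanMatrix n C)
    (hodd : ∀ i j : I, Odd (n i j) → C i j = C j i) (w : n.Group) {β : I → ℝ}
    (hβ : β ∈ positiveRoots hC) (hw : reflectionRep hC w β ≤ 0) :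
    ∃ i : I, DepthLE hC (simpleRoot i) β := by
  induction hl : n.toCoxeterSystem.length w using Nat.strong_induction_on generalizing w β with
  | _ l ih =>
    subst hl
    -- A `w` that is not shortest for `β` is replaced by a shorter one with the same `β`; a shortest
    -- one yields a depth step.
    by_cases hmin : ∀ v, reflectionRep hC v β ≤ 0 →
        n.toCoxeterSystem.length w ≤ n.toCoxeterSystem.length v
    · have hw1 : w ≠ 1 := by
        rintro rfl
        rw [map_one] at hw
        exact ne_zero_of_mem_roots hC hβ.1 (le_antisymm hw hβ.2)
      obtain ⟨i, hi⟩ := n.toCoxeterSystem.exists_rightDescent_of_ne_one hw1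
      by_cases hβi : β = simpleRoot i
      · exact ⟨i, Or.inl hβi.symm⟩
      have hpos := simpleCoroot_pos_of_minimal hC hw hmin hi
      have hγ := simpleReflection_mem_positiveRoots hC hodd hβ hβi
      have hinv : simpleReflection C i (simpleReflection C i β) = β :=
        Module.involutive_preReflection (by rw [simpleCoroot_simpleRoot, hC.diag]) β
      have hstep : DepthStep hC (simpleReflection C i β) β := by
        refine ⟨hγ, hβ, i, hinv.symm, ?_⟩
        rw [hinv, simpleReflection, Module.preReflection_apply]
        simpa [simpleRoot] using hpos
      obtain ⟨j, hj⟩ := ih _ hi (w * n.toCoxeterSystem.simple i) hγ (by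
        rwa [map_mul, n.toCoxeterSystem_simple, reflectionRep_simple, Module.End.mul_apply, hinv])
        rfl
      refine ⟨j, Or.inr ?_⟩
      rcases hj with hj | hj
      · exact Relation.TransGen.single (hj ▸ hstep)
      · exact Relation.TransGen.tail hj hstep
    · push Not at hmin
      obtain ⟨v, hv, hlt⟩ := hmin
      exact ih _ hlt v hβ hv rfl

end

end NumbersGame

theorem lemma5p5 {I : Type*} [Fintype I] [DecidableEq I] (n : CoxeterMatrix I)
    (C : Matrix I I ℝ) (hC : NumbersGame.IsCartanMatrix n C)
    (hodd : ∀ i j : I, Odd (n i j) → C i j = C j i) :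
    ∀ β ∈ NumbersGame.positiveRoots hC,
      ∃ i : I, NumbersGame.DepthLE hC (NumbersGame.simpleRoot i) β := by
  intro β hβ
  obtain ⟨w, hw⟩ := NumbersGame.exists_reflectionRep_nonpos hC hβ.1
  exact NumbersGame.exists_simpleRoot_depthLE hC hodd w hβ hw
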